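/- Let $L$ be a field, let $\sigma\in\operatorname{Aut}(L)$ be a field automorphism of finite order $n$, with invariant subfield $L^\sigma$, and let $\alpha\in L$ be such that $\{\alpha,\sigma(\alpha),\dots,\sigma^{n-1}(\alpha)\}$ is a (normal) basis of $L$ over $L^\sigma$. Put $\beta=\alpha^{-1}\sigma(\alpha)$. Let $L[x;\sigma]$ be the skew polynomial ring (with $xa=\sigma(a)x$ for $a\in L$), let $\mathcal R=L[x;\sigma]/\langle x^n-1\rangle$, and identify $(c_0,\dots,c_{n-1})\in L^n$ with the class of $\sum_i c_ix^i$ in $\mathcal R$. Let $2\le\delta\le n$, let $g=\operatorname{lclm}\{x-\beta,x-\sigma(\beta),\dots,x-\sigma^{\delta-2}(\beta)\}$ be a least common left multiple, i.e. $L[x;\sigma]\,g=\bigcap_{i=0}^{\delta-2}L[x;\sigma](x-\sigma^i(\beta))$, and let $\mathcal C\subseteq L^n$ be the skew RS code that corresponds to the left ideal $\mathcal Rg$. Put $t=\lfloor(\delta-1)/2\rfloor$, and for $\gamma\in L$ and $i\ge 0$ write $N_i(\gamma)=\gamma\,\sigma(\gamma)\cdots\sigma^{i-1}(\gamma)$.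 All coordinates, rows and columns are numbered from $0$, $\varepsilon_0,\dots,\varepsilon_{n-1}$ are the canonical vectors of $L^n$, and rref and rcef denote the reduced row and reduced column echelon forms. Consider the following decoding algorithm, whose input is $y=(y_0,\dots,y_{n-1})\in L^n$. 1. For $0\le i\le 2t-1$ compute the syndrome $s_i=\sum_{j=0}^{n-1}y_jN_j(\sigma^i(\beta))$. If all these $s_i$ are $0$ (in particular if $t=0$), return $0\in L^n$. 2. Form the $(t+1)\times t$ matrix $S=\bigl(\sigma^{-j}(s_{i+j})\,\sigma^i(\alpha)\bigr)_{0\le i\le t,\ 0\le j\le t-1}$ and compute $\operatorname{rcef}(S)$, which is required to have the form $$\left(\begin{array}{c|c}\begin{array}{c}I_\mu\\ a_0\ \cdots\ a_{\mu-1}\\ *\end{array}&0\end{array}\right),$$ where $\mu$ is the number of its nonzero columns and $I_\mu$ is the identity matrix of size $\mu$. 3. Let $\rho=(\rho_0,\dots,\rho_\mu)=(-a_0,\dots,-a_{\mu-1},1)$, let $N=\bigl(N_i(\sigma^j(\beta))\bigr)_{0\le i,j\le n-1}$, and let $k_1<\dots<k_\nu$ be the zero coordinates of $(\rho_0,\dots,\rho_\mu,0,\dots,0)N$.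 4. If $\nu\ne\mu$, let $M_\rho$ be the $(n-\mu)\times n$ matrix whose $i$-th row is $(0,\dots,0,\sigma^i(\rho_0),\dots,\sigma^i(\rho_\mu),0,\dots,0)$, with $i$ leading zeros, for $0\le i\le n-\mu-1$. Compute $H_\rho=\operatorname{rref}(M_\rho N)$, let $H'$ be the matrix obtained from $H_\rho$ by removing all rows that are not equal to some $\varepsilon_d$, and redefine $k_1<\dots<k_\nu$ to be the positions of the zero columns of $H'$. 5. Solve the linear system $\sum_{j=1}^{\nu}x_j\,\sigma^{k_j+i}(\alpha)=\sigma^i(\alpha)\,s_i$, $0\le i\le\nu-1$, which is required to have a unique solution, and return the vector of $L^n$ whose coordinate at the position $k_j$ is $x_j$ for $1\le j\le\nu$ and whose other coordinates are $0$. Theorem. If $y=c+e$ with $c\in\mathcal C$ and $e\in L^n$ having at most $t$ nonzero coordinates, then every step of the algorithm can be carried out on the input $y$ (that is, the requirements in steps 2 and 5 are met), and the algorithm returns $e$. -/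

import Mathlib

/-! ### Skew polynomials and skew Reed–Solomon codes -/

namespace SkewRS

variable {L : Type*} [Field L]

/-- The action of the additive monoid of natural numbers on `L` in which `i` acts as `σ ^ i`. -/
abbrev powAction (σ : RingAut L) : MulSemiringAction (Multiplicative ℕ) L :=
  MulSemiringAction.compHom L (powersHom (RingAut L) σ)

/-- The skew polynomial ring `L[x;σ]`: left polynomials `∑ aᵢ xⁱ` with `x * a = σ(a) * x`. -/
def SkewPoly (_σ : RingAut L) : Type _ := SkewPolynomial L

noncomputable instance (σ : RingAut L) : Ring (SkewPoly σ) :=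
  letI := powAction σ
  inferInstanceAs (Ring (SkewPolynomial L))

/-- The skew polynomial `a xⁱ`. -/
noncomputable def monom (σ : RingAut L) (i : ℕ) (a : L) : SkewPoly σ :=
  SkewPolynomial.monomial i a

/-- The indeterminate `x` of `L[x;σ]`. -/
noncomputable def X (σ : RingAut L) : SkewPoly σ := monom σ 1 1

/-- The constant skew polynomial `a`. -/
noncomputable def C (σ : RingAut L) (a : L) : SkewPoly σ := monom σ 0 a

theorem monom_mul_monom (σ : RingAut L) (i j : ℕ) (a b : L) :
    monom σ i a * monom σ j b = monom σ (i + j) (a * (σ ^ i) b) := by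
  let _ := powAction σ
  have h := SkewPolynomial.monomial_mul_monomial (R := L) i j a b
  rw [SkewPolynomial.φ_iterate_apply] at h
  exact h

theorem X_mul_C (σ : RingAut L) (a : L) : X σ * C σ a = C σ (σ a) * X σ := by
  simp [X, C, monom_mul_monom]

theorem monom_add (σ : RingAut L) (i : ℕ) (a b : L) :
    monom σ i (a + b) = monom σ i a + monom σ i b :=
  map_add (SkewPolynomial.monomial (R := L) i) a b

theorem monom_zero (σ : RingAut L) (i : ℕ) : monom σ i (0 : L) = 0 :=
  map_zero (SkewPolynomial.monomial (R := L) i)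

/-- `g` is a least common left multiple of the family `f`, that is `Rg = ⋂ᵢ R fᵢ`
for `R = L[x;σ]` (ideals of noncommutative rings are left ideals here). -/
def IsLCLM {σ : RingAut L} {ι : Type*} (g : SkewPoly σ) (f : ι → SkewPoly σ) : Prop :=
  Ideal.span {g} = ⨅ i, Ideal.span {f i}

/-- The quotient ring `L[x;σ] / ⟨xⁿ - 1⟩` by the two-sided ideal generated by `xⁿ - 1`. -/
abbrev SkewQuot (σ : RingAut L) (n : ℕ) : Type _ :=
  (TwoSidedIdeal.span {X σ ^ n - 1}).ringCon.Quotient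

/-- The canonical projection from `L[x;σ]` onto `L[x;σ] / ⟨xⁿ - 1⟩`. -/
noncomputable def toQuot (σ : RingAut L) (n : ℕ) : SkewPoly σ →+* SkewQuot σ n :=
  (TwoSidedIdeal.span {X σ ^ n - 1}).ringCon.mk'

/-- The inverse of the coordinate map: a vector `(c₀, …, cₙ₋₁)` is identified with the class of
`c₀ + c₁ x + ⋯ + cₙ₋₁ xⁿ⁻¹`. -/
noncomputable def ofVec (σ : RingAut L) (n : ℕ) (c : Fin n → L) : SkewQuot σ n :=
  toQuot σ n (∑ i : Fin n, monom σ i (c i))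

/-- The skew cyclic code of length `n` generated by `g`: the vectors of `Lⁿ` that correspond to the
left ideal generated by the class of `g` in `L[x;σ] / ⟨xⁿ - 1⟩`. -/
noncomputable def skewCode (σ : RingAut L) (n : ℕ) (g : SkewPoly σ) : Submodule L (Fin n → L) where
  carrier := {c | ofVec σ n c ∈ Ideal.span {toQuot σ n g}}
  add_mem' {a b} ha hb := by
    have h : ofVec σ n (a + b) = ofVec σ n a + ofVec σ n b := by
      simp [ofVec, monom_add, Finset.sum_add_distrib]
    simpa only [Set.mem_ofPred_eq, h] using add_mem ha hb
  zero_mem' := by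
    have h : ofVec σ n (0 : Fin n → L) = 0 := by simp [ofVec, monom_zero]
    simp [h]
  smul_mem' a c hc := by
    have h : ofVec σ n (a • c) = toQuot σ n (C σ a) * ofVec σ n c := by
      rw [ofVec, ofVec, ← map_mul, Finset.mul_sum]
      simp [C, monom_mul_monom]
    simpa only [Set.mem_ofPred_eq, h] using Ideal.mul_mem_left _ _ hc

/-- The invariant subfield `L^σ`. -/
abbrev invariantSubfield (σ : RingAut L) : Subfield L :=
  RingHom.eqLocusField (σ : L →+* L) (RingHom.id L)

/-- `{α, σ(α), …, σⁿ⁻¹(α)}` is a (normal) basis of `L` over `L^σ`. -/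
def IsNormalBasisGenerator (σ : RingAut L) (n : ℕ) (α : L) : Prop :=
  ∃ b : Module.Basis (Fin n) (invariantSubfield σ) L, ∀ i : Fin n, b i = (σ ^ (i : ℕ)) α

/-- The `i`-th norm `γ σ(γ) ⋯ σⁱ⁻¹(γ)`. -/
def skewNorm (σ : RingAut L) (i : ℕ) (γ : L) : L := ∏ k ∈ Finset.range i, (σ ^ k) γ

end SkewRS

/-! ### Gaussian elimination -/

namespace Gauss

variable {L : Type*} [Field L] {m n : ℕ}

/-- Exchange the rows `r` and `p`, divide the new row `r` by its entry in column `c`, and subtract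
multiples of it from all other rows in order to clear column `c`. -/
def pivot (M : Matrix (Fin m) (Fin n) L) (r p : Fin m) (c : Fin n) : Matrix (Fin m) (Fin n) L :=
  Matrix.of fun i j =>
    if i = r then (M p c)⁻¹ * M p j
    else M (Equiv.swap r p i) j - M (Equiv.swap r p i) c * ((M p c)⁻¹ * M p j)

/-- The entry at `(i, j)` is the first nonzero entry of the row `i`. -/
def IsLeading (R : Matrix (Fin m) (Fin n) L) (i : Fin m) (j : Fin n) : Prop :=
  R i j ≠ 0 ∧ ∀ k < j, R i k = 0

/-- `R` is in reduced row echelon form: every leading entry is `1` and is the only nonzero entry of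
its column, and above a nonzero row there are only nonzero rows, whose leading entries lie further
to the left. -/
def IsReducedRowEchelon (R : Matrix (Fin m) (Fin n) L) : Prop :=
  (∀ i j, IsLeading R i j → R i j = 1 ∧ ∀ i', i' ≠ i → R i' j = 0) ∧
  ∀ i i' j', i < i' → IsLeading R i' j' → ∃ j < j', IsLeading R i j

theorem IsLeading.unique {M : Matrix (Fin m) (Fin n) L} {i : Fin m} {j j' : Fin n}
    (h : IsLeading M i j) (h' : IsLeading M i j') : j = j' := by
  rcases lt_trichotomy j j' with hl | rfl | hl
  · exact absurd (h'.2 _ hl) h.1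
  · rfl
  · exact absurd (h.2 _ hl) h'.1

theorem span_pivot (M : Matrix (Fin m) (Fin n) L) (r p : Fin m) (c : Fin n) (hp : M p c ≠ 0) :
    Submodule.span L (Set.range (pivot M r p c)) = Submodule.span L (Set.range M) := by
  have hr : pivot M r p c r = (M p c)⁻¹ • M p := by
    ext j; simp [pivot]
  have hi : ∀ i, i ≠ r → pivot M r p c i =
      M (Equiv.swap r p i) - M (Equiv.swap r p i) c • ((M p c)⁻¹ • M p) := by
    intro i h; ext j; simp [pivot, h]
  apply le_antisymm
  · rw [Submodule.span_le]
    rintro _ ⟨i, rfl⟩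
    have hM : ∀ k, M k ∈ Submodule.span L (Set.range M) := fun k => Submodule.subset_span ⟨k, rfl⟩
    rcases eq_or_ne i r with rfl | h
    · rw [hr]; exact Submodule.smul_mem _ _ (hM p)
    · rw [hi i h]
      exact sub_mem (hM _) (Submodule.smul_mem _ _ (Submodule.smul_mem _ _ (hM p)))
  · rw [Submodule.span_le]
    rintro _ ⟨k, rfl⟩
    have hP : ∀ k, pivot M r p c k ∈ Submodule.span L (Set.range (pivot M r p c)) :=
      fun k => Submodule.subset_span ⟨k, rfl⟩
    have h1 : (M p c)⁻¹ • M p ∈ Submodule.span L (Set.range (pivot M r p c)) := hr ▸ hP r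
    rcases eq_or_ne k p with rfl | h
    · have := Submodule.smul_mem _ (M k c) h1
      rwa [smul_smul, mul_inv_cancel₀ hp, one_smul] at this
    · have hne : Equiv.swap r p k ≠ r := by
        intro hk
        apply h
        have := congrArg (Equiv.swap r p) hk
        simpa using this
      have h2 := hP (Equiv.swap r p k)
      rw [hi _ hne, Equiv.swap_apply_self] at h2
      have := add_mem h2 (Submodule.smul_mem _ (M k c) h1)
      simpa using this

variable [DecidableEq L]

/-- One step of Gauss–Jordan elimination, which treats column `c`; the second component of the state
is the number of pivots found so far. -/
def step (s : Matrix (Fin m) (Fin n) L × ℕ) (c : Fin n) : Matrix (Fin m) (Fin n) L × ℕ :=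
  if hr : s.2 < m then
    match (List.finRange m).find? (fun i : Fin m => s.2 ≤ (i : ℕ) ∧ s.1 i c ≠ 0) with
    | none => s
    | some p => (pivot s.1 ⟨s.2, hr⟩ p c, s.2 + 1)
  else s

/-- The state of Gauss–Jordan elimination after the first `c` columns have been treated. -/
def eliminate (M : Matrix (Fin m) (Fin n) L) : ℕ → Matrix (Fin m) (Fin n) L × ℕ
  | 0 => (M, 0)
  | c + 1 => if hc : c < n then step (eliminate M c) ⟨c, hc⟩ else eliminate M c

/-- The reduced row echelon form of a matrix, computed by Gauss–Jordan elimination. -/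
def rref (M : Matrix (Fin m) (Fin n) L) : Matrix (Fin m) (Fin n) L := (eliminate M n).1

/-- The state after the first `c` columns have been treated, with `r` pivots found. -/
def EchelonUpTo (M : Matrix (Fin m) (Fin n) L) (r c : ℕ) : Prop :=
  (∀ i : Fin m, r ≤ (i : ℕ) → ∀ j : Fin n, (j : ℕ) < c → M i j = 0) ∧
  (∀ i : Fin m, (i : ℕ) < r → ∃ j : Fin n, (j : ℕ) < c ∧ IsLeading M i j ∧ M i j = 1 ∧
    ∀ i', i' ≠ i → M i' j = 0) ∧
  ∀ (i i' : Fin m) (j j' : Fin n), i < i' → (i' : ℕ) < r → IsLeading M i j → IsLeading M i' j' → j < j'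

theorem echelonUpTo_step {M : Matrix (Fin m) (Fin n) L} {r : ℕ} (c : Fin n)
    (h : EchelonUpTo M r c) : EchelonUpTo (step (M, r) c).1 (step (M, r) c).2 (c + 1) := by
  have hkeep : (∀ i : Fin m, r ≤ (i : ℕ) → M i c = 0) → EchelonUpTo M r (c + 1) := by
    intro h0
    refine ⟨fun i hi j hj => ?_, fun i hi => ?_, h.2.2⟩
    · rcases Nat.lt_succ_iff_lt_or_eq.mp hj with hj | hj
      · exact h.1 i hi j hj
      · obtain rfl : j = c := Fin.ext hj
        exact h0 i hi
    · obtain ⟨j, hj, h'⟩ := h.2.1 i hi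
      exact ⟨j, hj.trans (Nat.lt_succ_self _), h'⟩
  by_cases hr : r < m
  swap
  · rw [step, dif_neg hr]
    exact hkeep fun i hi => absurd (hi.trans_lt i.2) hr
  cases hf : (List.finRange m).find? (fun i : Fin m => r ≤ (i : ℕ) ∧ M i c ≠ 0) with
  | none =>
    have hs : step (M, r) c = (M, r) := by
      rw [step, dif_pos hr]; simp only [hf]
    rw [hs]
    refine hkeep fun i hi => ?_
    have := List.find?_eq_none.mp hf i (List.mem_finRange i)
    by_contra hne
    exact this (by simp [hi, hne])
  | some p =>
    have hs : step (M, r) c = (pivot M ⟨r, hr⟩ p c, r + 1) := by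
      rw [step, dif_pos hr]; simp only [hf]
    rw [hs]
    change EchelonUpTo (pivot M ⟨r, hr⟩ p c) (r + 1) (c + 1)
    have hp : r ≤ (p : ℕ) ∧ M p c ≠ 0 := by simpa using List.find?_some hf
    set q : Fin m := ⟨r, hr⟩ with hq
    have hpz : ∀ j : Fin n, (j : ℕ) < c → M p j = 0 := h.1 p hp.1
    have hrow : ∀ j, pivot M q p c q j = (M p c)⁻¹ * M p j := fun j => by simp [pivot]
    have hlt : ∀ i : Fin m, (i : ℕ) < r → Equiv.swap q p i = i := by
      intro i hi
      apply Equiv.swap_apply_of_ne_of_ne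
      · rintro rfl; simp [hq] at hi
      · rintro rfl; omega
    have hge : ∀ i : Fin m, r ≤ (i : ℕ) → r ≤ (Equiv.swap q p i : ℕ) := by
      intro i hi
      rcases eq_or_ne i q with rfl | h1
      · simpa using hp.1
      · rcases eq_or_ne i p with rfl | h2
        · simp [hq]
        · rwa [Equiv.swap_apply_of_ne_of_ne h1 h2]
    have hother : ∀ i, i ≠ q → ∀ j : Fin n, pivot M q p c i j =
        M (Equiv.swap q p i) j - M (Equiv.swap q p i) c * ((M p c)⁻¹ * M p j) := by
      intro i hi j; simp [pivot, hi]
    have hother' : ∀ i, i ≠ q → ∀ j : Fin n, (j : ℕ) < c →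
        pivot M q p c i j = M (Equiv.swap q p i) j := by
      intro i hi j hj; rw [hother i hi, hpz j hj]; simp
    have hotherc : ∀ i, i ≠ q → pivot M q p c i c = 0 := by
      intro i hi; rw [hother i hi, inv_mul_cancel₀ hp.2]; simp
    have hqc : pivot M q p c q c = 1 := by rw [hrow, inv_mul_cancel₀ hp.2]
    have hql : IsLeading (pivot M q p c) q c := by
      refine ⟨by rw [hqc]; exact one_ne_zero, fun k hk => ?_⟩
      rw [hrow, hpz k hk, mul_zero]
    have hneq : ∀ i : Fin m, (i : ℕ) < r → i ≠ q := by
      rintro i hi rfl; simp [hq] at hi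
    have hold : ∀ i : Fin m, (i : ℕ) < r → ∃ j : Fin n, (j : ℕ) < c ∧ IsLeading M i j ∧
        IsLeading (pivot M q p c) i j ∧ pivot M q p c i j = 1 ∧
        ∀ i', i' ≠ i → pivot M q p c i' j = 0 := by
      intro i hi
      obtain ⟨j, hj, hl, h1, h0⟩ := h.2.1 i hi
      have e : ∀ k : Fin n, (k : ℕ) < c → pivot M q p c i k = M i k := by
        intro k hk; rw [hother' i (hneq i hi) k hk, hlt i hi]
      refine ⟨j, hj, hl, ⟨by rw [e j hj]; exact hl.1, fun k hk => ?_⟩, by rw [e j hj, h1], ?_⟩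
      · rw [e k (lt_trans hk hj)]; exact hl.2 k hk
      · intro i' hi'
        rcases eq_or_ne i' q with rfl | hq'
        · rw [hrow, hpz j hj, mul_zero]
        · rw [hother' i' hq' j hj]
          apply h0
          intro hs'
          apply hi'
          have := congrArg (Equiv.swap q p) hs'
          rwa [Equiv.swap_apply_self, hlt i hi] at this
    refine ⟨fun i hi j hj => ?_, fun i hi => ?_, fun i i' j j' hii hi' hl hl' => ?_⟩
    · have hiq : i ≠ q := by rintro rfl; simp [hq] at hi
      rcases Nat.lt_succ_iff_lt_or_eq.mp hj with hj | hj
      · rw [hother' i hiq j hj]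
        exact h.1 _ (hge i (by omega)) j hj
      · obtain rfl : j = c := Fin.ext hj
        exact hotherc i hiq
    · rcases Nat.lt_succ_iff_lt_or_eq.mp hi with hi | hi
      · obtain ⟨j, hj, -, h'⟩ := hold i hi
        exact ⟨j, hj.trans (Nat.lt_succ_self _), h'⟩
      · obtain rfl : i = q := Fin.ext hi
        exact ⟨c, Nat.lt_succ_self _, hql, hqc, hotherc⟩
    · have hir : (i : ℕ) < r := by
        have : (i : ℕ) < i' := hii
        omega
      obtain ⟨k, hk, hkl, hkl', -⟩ := hold i hir
      obtain rfl := hl.unique hkl'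
      rcases Nat.lt_succ_iff_lt_or_eq.mp hi' with hi' | hi'
      · obtain ⟨k', -, hk1, hk2, -⟩ := hold i' hi'
        obtain rfl := hl'.unique hk2
        exact h.2.2 i i' j j' hii hi' hkl hk1
      · obtain rfl : i' = q := Fin.ext hi'
        obtain rfl := hl'.unique hql
        exact hk

theorem echelonUpTo_eliminate (M : Matrix (Fin m) (Fin n) L) {c : ℕ} (hc : c ≤ n) :
    EchelonUpTo (eliminate M c).1 (eliminate M c).2 c := by
  induction c with
  | zero => exact ⟨fun _ _ _ hj => absurd hj (Nat.not_lt_zero _),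
      fun _ hi => absurd hi (Nat.not_lt_zero _), fun _ _ _ _ _ hi => absurd hi (Nat.not_lt_zero _)⟩
  | succ c ih =>
    rw [eliminate, dif_pos (Nat.lt_of_succ_le hc)]
    exact echelonUpTo_step ⟨c, hc⟩ (ih (Nat.le_of_succ_le hc))

theorem span_step (s : Matrix (Fin m) (Fin n) L × ℕ) (c : Fin n) :
    Submodule.span L (Set.range (step s c).1) = Submodule.span L (Set.range s.1) := by
  by_cases hr : s.2 < m
  swap
  · rw [step, dif_neg hr]
  cases hf : (List.finRange m).find? (fun i : Fin m => s.2 ≤ (i : ℕ) ∧ s.1 i c ≠ 0) with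
  | none => rw [step, dif_pos hr]; simp only [hf]
  | some p =>
    have hp : s.2 ≤ (p : ℕ) ∧ s.1 p c ≠ 0 := by simpa using List.find?_some hf
    have hs : step s c = (pivot s.1 ⟨s.2, hr⟩ p c, s.2 + 1) := by
      rw [step, dif_pos hr]; simp only [hf]
    rw [hs]
    exact span_pivot _ _ _ _ hp.2

/-- Row reduction preserves the row space. -/
theorem span_rref (M : Matrix (Fin m) (Fin n) L) :
    Submodule.span L (Set.range (rref M)) = Submodule.span L (Set.range M) := by
  suffices h : ∀ c, Submodule.span L (Set.range (eliminate M c).1) =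
      Submodule.span L (Set.range M) from h n
  intro c
  induction c with
  | zero => rfl
  | succ c ih =>
    by_cases hc : c < n
    · rw [eliminate, dif_pos hc, span_step, ih]
    · rw [eliminate, dif_neg hc, ih]

theorem isReducedRowEchelon_rref (M : Matrix (Fin m) (Fin n) L) :
    IsReducedRowEchelon (rref M) := by
  obtain ⟨h0, h1, h2⟩ := echelonUpTo_eliminate M le_rfl
  have hlt : ∀ i j, IsLeading (rref M) i j → (i : ℕ) < (eliminate M n).2 := by
    intro i j hl
    by_contra hi
    exact hl.1 (h0 i (not_lt.mp hi) j j.2)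
  refine ⟨fun i j hl => ?_, fun i i' j' hii hl' => ?_⟩
  · obtain ⟨k, -, hk, h⟩ := h1 i (hlt i j hl)
    obtain rfl := hl.unique hk
    exact h
  · have hi' := hlt i' j' hl'
    obtain ⟨j, -, hj, -⟩ := h1 i (lt_trans hii hi')
    exact ⟨j, h2 i i' j j' hii hi' hj hl', hj⟩

/-- The reduced column echelon form of a matrix. -/
def rcef (M : Matrix (Fin m) (Fin n) L) : Matrix (Fin m) (Fin n) L :=
  (rref M.transpose).transpose

/-- Solve the square linear system `A x = b` by Gauss–Jordan elimination of the augmented matrix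
`(A | b)`. The result is `none` if the left block does not become the identity matrix. -/
def solve (A : Matrix (Fin m) (Fin m) L) (b : Fin m → L) : Option (Fin m → L) :=
  let R : Matrix (Fin m) (Fin (m + 1)) L :=
    rref (Matrix.of fun i => (Fin.snoc (A i) (b i) : Fin (m + 1) → L))
  if ∀ i j : Fin m, R i j.castSucc = if i = j then 1 else 0 then
    some fun i => R i (Fin.last m)
  else none

end Gauss

/-! ### The decoding algorithm -/

namespace PGZ

open SkewRS

variable {L : Type*} [Field L] [DecidableEq L]

/-- The number `μ` of nonzero columns of a matrix. -/
def numNonzeroCols {a b : ℕ} (R : Matrix (Fin a) (Fin b) L) : ℕ :=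
  (Finset.univ.filter fun j : Fin b => ∃ i, R i j ≠ 0).card

theorem numNonzeroCols_le {a b : ℕ} (R : Matrix (Fin a) (Fin b) L) : numNonzeroCols R ≤ b :=
  (Finset.card_le_univ _).trans_eq (Fintype.card_fin b)

/-- The `i`-th syndrome `∑ⱼ yⱼ Nⱼ(σⁱ(β))`, where `β = α⁻¹ σ(α)`. -/
def syndrome (σ : RingAut L) (α : L) {n : ℕ} (y : Fin n → L) (i : ℕ) : L :=
  ∑ j : Fin n, y j * skewNorm σ j ((σ ^ i) (α⁻¹ * σ α))

/-- The `(t+1) × t` syndrome matrix with entries `σ⁻ʲ(sᵢ₊ⱼ) σⁱ(α)`. -/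
def syndromeMatrix (σ : RingAut L) (α : L) (t : ℕ) (s : ℕ → L) :
    Matrix (Fin (t + 1)) (Fin t) L :=
  Matrix.of fun i j => (σ ^ (j : ℕ))⁻¹ (s (i + j)) * (σ ^ (i : ℕ)) α

/-- The matrix `R` has the block form in which the columns from the `μ`-th on are zero, and the
first `μ` columns start with the `μ × μ` identity matrix; here `μ` is the number of nonzero columns,
and rows and columns are numbered from `0`. -/
def HasIdentityBlock {t : ℕ} (R : Matrix (Fin (t + 1)) (Fin t) L) : Prop :=
  ∀ (i : Fin (t + 1)) (j : Fin t),
    ((i : ℕ) < numNonzeroCols R → (j : ℕ) < numNonzeroCols R →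
      R i j = if (i : ℕ) = j then 1 else 0) ∧
    (numNonzeroCols R ≤ (j : ℕ) → R i j = 0)

instance {t : ℕ} (R : Matrix (Fin (t + 1)) (Fin t) L) : Decidable (HasIdentityBlock R) :=
  @Fintype.decidableForallFintype _ _ (fun _ => inferInstance) _

/-- The coefficients `(-a₀, …, -a_{μ-1}, 1, 0, 0, …)` of `ρ`, where `(a₀ ⋯ a_{μ-1})` is the row of
index `μ` of `R`, directly below the identity block, and `μ` is the number of nonzero columns. -/
def rhoCoeff {t : ℕ} (R : Matrix (Fin (t + 1)) (Fin t) L) (k : ℕ) : L :=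
  if hk : k < numNonzeroCols R then
    - R ⟨numNonzeroCols R, Nat.lt_succ_of_le (numNonzeroCols_le R)⟩
        ⟨k, hk.trans_le (numNonzeroCols_le R)⟩
  else if k = numNonzeroCols R then 1 else 0

/-- The matrix `N` of the norms of the `β`-roots, with entries `Nᵢ(σʲ(β))`. -/
def normMatrix (σ : RingAut L) (α : L) (n : ℕ) : Matrix (Fin n) (Fin n) L :=
  Matrix.of fun i j => skewNorm σ i ((σ ^ (j : ℕ)) (α⁻¹ * σ α))

/-- The `(n-μ) × n` matrix `M_ρ` whose `i`-th row holds the coefficients of `xⁱ ρ`. -/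
def multMatrix (σ : RingAut L) (n μ : ℕ) (ρ : ℕ → L) : Matrix (Fin (n - μ)) (Fin n) L :=
  Matrix.of fun i j =>
    if (i : ℕ) ≤ j then (σ ^ (i : ℕ)) (ρ ((j : ℕ) - i)) else 0

/-- The zero coordinates of a vector, in increasing order. -/
def zeroCoords {n : ℕ} (v : Fin n → L) : List (Fin n) :=
  (List.finRange n).filter fun i => v i = 0

/-- The rows of `H` that are canonical vectors. -/
def canonicalRows {k n : ℕ} (H : Matrix (Fin k) (Fin n) L) : List (Fin n → L) :=
  ((List.finRange k).map fun i => H i).filter fun v => ∃ d : Fin n, v = Pi.single d 1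

/-- The indices of the zero columns of a matrix given by the list of its rows, in increasing
order. -/
def zeroCols {n : ℕ} (H : List (Fin n → L)) : List (Fin n) :=
  (List.finRange n).filter fun j => ∀ v ∈ H, v j = 0

/-- The list of error positions computed from `ρ`, whose degree is `μ`: the zero coordinates of
`ρ N` if there are exactly `μ` of them; otherwise, the zero columns of the matrix obtained from
`rref (M_ρ N)` by removing all rows that are not canonical vectors. -/
def errorPositions (σ : RingAut L) (α : L) (n μ : ℕ) (ρ : ℕ → L) : List (Fin n) :=
  let N := normMatrix σ α n
  let K := zeroCoords (Matrix.vecMul (fun i : Fin n => ρ i) N)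
  if μ ≠ K.length then
    zeroCols (canonicalRows (Gauss.rref (multMatrix σ n μ ρ * N)))
  else K

/-- For the list `K = [k₁, …, k_ν]` of positions, solve the system
`∑ⱼ xⱼ σ^(kⱼ + i)(α) = σⁱ(α) sᵢ` (`0 ≤ i < ν`), and return the vector with the value `xⱼ` at the
position `kⱼ` and `0` elsewhere. -/
def errorVector (σ : RingAut L) (α : L) {n : ℕ} (s : ℕ → L) (K : List (Fin n)) :
    Option (Fin n → L) :=
  (Gauss.solve
    (Matrix.of fun i j : Fin K.length => (σ ^ ((K.get j : ℕ) + (i : ℕ))) α)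
    (fun i => (σ ^ (i : ℕ)) α * s i)).map
  fun x k => ∑ j : Fin K.length, if K.get j = k then x j else 0

/-- The Peterson–Gorenstein–Zierler decoding algorithm for the skew RS code of designed distance `δ`
given by `σ` and `α`, applied to the received vector `y`. The result is `none` if the reduced column
echelon form of the syndrome matrix does not have the block form from which `ρ` is read off, or
if the final linear system does not have a unique solution. -/
def decode (σ : RingAut L) (α : L) (δ : ℕ) {n : ℕ} (y : Fin n → L) : Option (Fin n → L) :=
  let t := (δ - 1) / 2
  let s := syndrome σ α y
  if ∀ i < 2 * t, s i = 0 then some 0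
  else
    let R := Gauss.rcef (syndromeMatrix σ α t s)
    if HasIdentityBlock R then
      errorVector σ α s (errorPositions σ α n (numNonzeroCols R) (rhoCoeff R))
    else none

end PGZ

/-!
The decoder recovers `e` because everything it computes depends only on one space of vectors.

Write `P i v = ∑ₖ vₖ σ^(i + k)(α)` (`SkewRS.conjSum`). For `β = α⁻¹ σ(α)` the norms are
`Nₖ(σⁱ(β)) = σ^(i + k)(α) / σⁱ(α)`, so the `i`-th syndrome of `y` is `P i y / σⁱ(α)`. Skew polynomials
act on `L`, with `x` acting as `σ`; the polynomial `x - σⁱ(β)` kills `σⁱ(α)`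
and `xⁿ - 1` acts as zero, so the syndromes of codewords vanish
(`SkewRS.sum_mul_eq_zero_of_mem_skewCode`) and those of `y` are those of `e`.

Let `U` be the `L`-span of the vectors obtained from `e` by applying powers of `σ⁻¹` to all coordinates
(`SkewRS.conjSpan`), and let `μ = dim U`, which is at most the weight of `e`. The spanning vectors of
`U`, and likewise the linear forms `P i` on `U`, form sequences in which each term is the image of the
previous one under a semilinear map. In such a sequence the first `dim` terms span everything
(`SkewRS.mem_span_of_semilinear_recurrence`). Therefore the first `t` conjugates of `e` span `U`, and
the forms `P i` with `i < μ` separate the vectors of `U` (`SkewRS.eq_zero_of_conjSum_eq_zero`), because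
all `P i` together do so by the independence of characters.

The columns of the syndrome matrix are the images of conjugates of `e` under `(P 0, …, P t)`. So the
column space is isomorphic to `U`, its vectors are determined by their first `μ` coordinates, and the
reduced column echelon form has the required block form. The row `ρ` is orthogonal to the columns,
which says that the values of `ρ` at `α, σ(α), …` form a vector orthogonal to `U`; as `U` is stable under
`σ⁻¹`, the same holds for all multiples `xⁱ ρ`. By counting dimensions, the row space of `M_ρ N` is, up
to a diagonal scaling, the orthogonal space of `U`. It contains a canonical vector exactly when the
corresponding coordinate of `e` is zero, and the canonical vectors of a row space are rows of the
reduced row echelon form (`Gauss.exists_rref_row_eq_single_iff`), so step 4 yields the support of `e`.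
If `ρ N` has exactly `μ` zero coordinates, the row space of `M_ρ N` consists of all vectors that vanish
at these coordinates, so they already are the support of `e` (`PGZ.errorPositions_eq`). Finally, the
matrix of the last linear system is invertible by the separation property, applied to the space of
vectors supported on the error positions.
-/

/-! ### Row reduction -/

namespace Gauss

variable {L : Type*} [Field L] [DecidableEq L] {m n : ℕ}

/-- The shape of the reduced row echelon form: the rows from the `r`-th on are zero, the first `r`
rows have strictly increasing pivot columns `p`, and each pivot column is a canonical vector. -/
theorem exists_pivots_rref (M : Matrix (Fin m) (Fin n) L) :
    ∃ (r : ℕ) (hr : r ≤ m) (p : Fin r → Fin n), StrictMono p ∧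
      (∀ i : Fin m, r ≤ (i : ℕ) → rref M i = 0) ∧
      (∀ (k : Fin r) (i : Fin m), rref M i (p k) = if i = k.castLE hr then 1 else 0) ∧
      ∀ (k : Fin r) (j : Fin n), j < p k → rref M (k.castLE hr) j = 0 := by
  obtain ⟨h0, h1, h2⟩ := echelonUpTo_eliminate M le_rfl
  have hlt : ∀ k : Fin (min m (eliminate M n).2),
      ((k.castLE (min_le_left _ _) : Fin m) : ℕ) < (eliminate M n).2 :=
    fun k => k.2.trans_le (min_le_right _ _)
  -- `eliminate` does not record that there are at most `m` pivots, hence the minimum.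
  choose p _ hp hp1 hp0 using fun k => h1 _ (hlt k)
  refine ⟨_, min_le_left _ _, p, fun k k' hk => h2 _ _ _ _ ?_ (hlt k') (hp k) (hp k'),
    fun i hi => ?_, fun k i => ?_, fun k j hj => (hp k).2 j hj⟩
  · simpa using hk
  · ext j
    have := i.2
    exact h0 i (by omega) j j.2
  · split_ifs with h
    · subst h; exact hp1 k
    · exact hp0 k i h

/-- If the row space of `M` has dimension `μ` and a vector of it is determined by its first `μ`
coordinates, then `rref M` consists of `μ` rows starting with the identity, followed by zero
rows. -/
theorem rref_eq_identity_block (M : Matrix (Fin m) (Fin n) L) {μ : ℕ}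
    (hrank : Module.finrank L (Submodule.span L (Set.range M)) = μ)
    (hinj : ∀ v ∈ Submodule.span L (Set.range M), (∀ j : Fin n, (j : ℕ) < μ → v j = 0) → v = 0) :
    (∀ (i : Fin m) (j : Fin n), (i : ℕ) < μ → (j : ℕ) < μ →
      rref M i j = if (i : ℕ) = j then 1 else 0) ∧
    ∀ i : Fin m, μ ≤ (i : ℕ) → rref M i = 0 := by
  obtain ⟨r, hr, p, hmono, hzero, hpiv, hlead⟩ := exists_pivots_rref M
  have hmem : ∀ i, rref M i ∈ Submodule.span L (Set.range M) := fun i => by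
    rw [← span_rref]; exact Submodule.subset_span ⟨i, rfl⟩
  -- A nonzero row whose pivot lies beyond the first `μ` columns would violate `hinj`.
  have hp : ∀ k, (p k : ℕ) < μ := by
    intro k
    by_contra hk
    have h := hinj _ (hmem (k.castLE hr)) fun j hj => hlead k j (by
      rw [Fin.lt_def]; omega)
    have h1 := hpiv k (k.castLE hr)
    rw [h] at h1
    simp at h1
  have hrμ : r ≤ μ := by
    have : Function.Injective fun k => (⟨p k, hp k⟩ : Fin μ) := fun k k' h =>
      hmono.injective (Fin.ext (by simpa using h))
    simpa using Fintype.card_le_of_injective _ this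
  have hμr : μ ≤ r := by
    rw [← hrank, ← span_rref]
    have : Submodule.span L (Set.range (rref M)) ≤
        Submodule.span L (Set.range fun k : Fin r => rref M (k.castLE hr)) := by
      rw [Submodule.span_le]
      rintro _ ⟨i, rfl⟩
      by_cases hi : (i : ℕ) < r
      · exact Submodule.subset_span ⟨⟨i, hi⟩, rfl⟩
      · rw [hzero i (not_lt.mp hi)]; exact zero_mem _
    refine (Submodule.finrank_mono this).trans ?_
    exact (finrank_range_le_card (R := L) fun k : Fin r => rref M (k.castLE hr)).trans_eq
      (Fintype.card_fin r)
  obtain rfl : r = μ := le_antisymm hrμ hμr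
  -- A strictly increasing self-map of `Fin r` is the identity.
  have hpk : ∀ k, (p k : ℕ) = k := by
    intro k
    have hm : StrictMono fun k => (⟨p k, hp k⟩ : Fin r) := fun k k' h => hmono h
    have := (StrictMono.range_inj hm strictMono_id).mp
      (by rw [(Finite.surjective_of_injective hm.injective).range_eq, Set.range_id])
    exact congrArg Fin.val (congrFun this k)
  refine ⟨fun i j hi hj => ?_, hzero⟩
  have : j = p ⟨j, hj⟩ := Fin.ext (hpk ⟨j, hj⟩).symm
  rw [this, hpiv, hpk]
  simp [Fin.ext_iff]

/-- A canonical vector lies in the row space of `M` if and only if it is a row of `rref M`: in a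
linear combination of rows, the coefficients can be read off at the pivot columns. -/
theorem exists_rref_row_eq_single_iff (M : Matrix (Fin m) (Fin n) L) (d : Fin n) :
    (∃ i, rref M i = Pi.single d 1) ↔ Pi.single d 1 ∈ Submodule.span L (Set.range M) := by
  rw [← span_rref]
  refine ⟨fun ⟨i, hi⟩ => hi ▸ Submodule.subset_span ⟨i, rfl⟩, fun h => ?_⟩
  obtain ⟨r, hr, p, hmono, hzero, hpiv, -⟩ := exists_pivots_rref M
  obtain ⟨a, ha⟩ := (Submodule.mem_span_range_iff_exists_fun L).mp h
  have hcoef : ∀ k, a (k.castLE hr) = (Pi.single d 1 : Fin n → L) (p k) := by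
    intro k
    rw [← ha]
    simp [Finset.sum_apply, hpiv]
  have hother : ∀ i : Fin m, (∀ k, p k = d → i ≠ k.castLE hr) → a i • rref M i = 0 := by
    intro i hi
    by_cases hir : (i : ℕ) < r
    · have hid : p ⟨i, hir⟩ ≠ d := fun hd => hi _ hd rfl
      have := hcoef ⟨i, hir⟩
      rw [Pi.single_eq_of_ne hid] at this
      have h' : a i = 0 := this
      rw [h', zero_smul]
    · rw [hzero i (not_lt.mp hir), smul_zero]
  by_cases hd : ∃ k, p k = d
  · obtain ⟨k, hk⟩ := hd
    refine ⟨k.castLE hr, ?_⟩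
    rw [← ha, Finset.sum_eq_single (k.castLE hr)]
    · rw [hcoef, hk, Pi.single_eq_same, one_smul]
    · intro i _ hi
      refine hother i fun k' hk' => ?_
      rwa [hmono.injective (hk'.trans hk.symm)]
    · simp
  · exfalso
    rw [Finset.sum_eq_zero fun i _ => hother i fun k hk => absurd ⟨k, hk⟩ hd] at ha
    simpa using congrFun ha d

/-- Gauss–Jordan elimination solves every linear system with an invertible matrix. -/
theorem solve_eq_some {A : Matrix (Fin m) (Fin m) L} (hA : IsUnit A) {b x : Fin m → L}
    (hx : A.mulVec x = b) : solve A b = some x := by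
  set M : Matrix (Fin m) (Fin (m + 1)) L :=
    Matrix.of fun i => (Fin.snoc (A i) (b i) : Fin (m + 1) → L) with hM
  have hcast : ∀ i (j : Fin m), M i j.castSucc = A i j := fun i j => by simp [hM]
  have hlast : ∀ i, M i (Fin.last m) = b i := fun i => by simp [hM]
  have hA' := Matrix.vecMul_injective_iff_isUnit.mpr hA
  have hcomb : ∀ a : Fin m → L, (∀ j : Fin m, (∑ i, a i • M i) j.castSucc = 0) → a = 0 := by
    intro a ha
    apply hA'
    ext j
    have := ha j
    simp only [Finset.sum_apply, Pi.smul_apply, smul_eq_mul, hcast] at this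
    simpa [Matrix.vecMul, dotProduct] using this
  have hli : LinearIndependent L M := by
    refine Fintype.linearIndependent_iff.mpr fun a ha i => ?_
    rw [hcomb a fun j => by rw [ha]; rfl]
    rfl
  -- The augmented matrix has rank `m`, and its row space projects injectively onto the columns of `A`.
  have hrank : Module.finrank L (Submodule.span L (Set.range M)) = m := by
    simpa using finrank_span_eq_card hli
  obtain ⟨hid, -⟩ := rref_eq_identity_block M hrank (by
    intro v hv h0
    obtain ⟨a, rfl⟩ := (Submodule.mem_span_range_iff_exists_fun L).mp hv
    rw [hcomb a fun j => h0 _ j.2]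
    simp)
  -- The vectors `v` of the row space of `(A | b)` satisfy `v_m = ∑ⱼ vⱼ xⱼ`.
  have hsol : ∀ i, rref M i (Fin.last m) = x i := by
    intro i
    have hmem : rref M i ∈ Submodule.span L (Set.range M) := by
      rw [← span_rref]; exact Submodule.subset_span ⟨i, rfl⟩
    obtain ⟨a, ha⟩ := (Submodule.mem_span_range_iff_exists_fun L).mp hmem
    have h : rref M i (Fin.last m) = ∑ j : Fin m, rref M i j.castSucc * x j := by
      rw [← ha]
      simp only [Finset.sum_apply, Pi.smul_apply, smul_eq_mul, hcast, hlast, ← hx,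
        Matrix.mulVec, dotProduct, Finset.mul_sum, Finset.sum_mul, mul_assoc]
      exact Finset.sum_comm
    rw [h]
    simp [hid _ (Fin.castSucc _) i.2, Fin.ext_iff.symm]
  have hcond : ∀ i j : Fin m, rref M i j.castSucc = if i = j then 1 else 0 := fun i j => by
    simp [hid i j.castSucc i.2 j.2, Fin.ext_iff]
  change (if ∀ i j : Fin m, rref M i j.castSucc = if i = j then 1 else 0 then
    some fun i => rref M i (Fin.last m) else none) = some x
  rw [if_pos hcond]
  exact congrArg some (funext hsol)

end Gauss

/-! ### The operator of a skew polynomial and the syndromes of codewords -/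

namespace SkewRS

variable {L : Type*} [Field L]

/-- The ring homomorphism from `L[x;σ]` to the additive endomorphisms of `L` under which constants
act by multiplication and `x` acts as `σ`. -/
noncomputable def operator (σ : RingAut L) : SkewPoly σ →+* AddMonoid.End L :=
  letI := powAction σ
  SkewMonoidAlgebra.liftNCRingHom (Module.toAddMonoidEnd L L)
    (DistribMulAction.toAddMonoidEnd (Multiplicative ℕ) L) (by
      intro x y
      refine AddMonoidHom.ext fun v => ?_
      exact (smul_mul' y x v).symm)

theorem operator_mul (σ : RingAut L) (f h : SkewPoly σ) (v : L) :
    operator σ (f * h) v = operator σ f (operator σ h v) := by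
  rw [map_mul]; rfl

theorem operator_sub (σ : RingAut L) (f h : SkewPoly σ) (v : L) :
    operator σ (f - h) v = operator σ f v - operator σ h v := by
  rw [map_sub]; rfl

theorem operator_one (σ : RingAut L) (v : L) : operator σ 1 v = v := by
  rw [map_one]; rfl

theorem operator_monom (σ : RingAut L) (i : ℕ) (a v : L) :
    operator σ (monom σ i a) v = a * (σ ^ i) v := by
  let _ := powAction σ
  have h : operator σ (monom σ i a) = Module.toAddMonoidEnd L L a *
      DistribMulAction.toAddMonoidEnd (Multiplicative ℕ) L (Multiplicative.ofAdd i) :=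
    SkewMonoidAlgebra.liftNC_single _ _ _ _
  rw [h]
  rfl

theorem operator_X_pow (σ : RingAut L) (i : ℕ) (v : L) :
    operator σ (X σ ^ i) v = (σ ^ i) v := by
  have h : ∀ v, operator σ (X σ) v = σ v := fun v => by simp [X, operator_monom]
  induction i generalizing v with
  | zero => rw [pow_zero, operator_one]; simp
  | succ i ih =>
    rw [pow_succ, operator_mul, ih, h, pow_succ]
    rfl

/-- As `σⁿ = 1`, the polynomial `xⁿ - 1` acts as zero, so the action on `L` only depends on the class
of a skew polynomial in `L[x;σ] / ⟨xⁿ - 1⟩`. -/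
theorem operator_eq_of_toQuot_eq {σ : RingAut L} {n : ℕ} (hσ : σ ^ n = 1) {f h : SkewPoly σ}
    (hfh : toQuot σ n f = toQuot σ n h) : operator σ f = operator σ h := by
  have hle : TwoSidedIdeal.span {X σ ^ n - 1} ≤ TwoSidedIdeal.ker (operator σ) := by
    rw [TwoSidedIdeal.span_le, Set.singleton_subset_iff, SetLike.mem_coe, TwoSidedIdeal.mem_ker]
    refine DFunLike.ext (F := AddMonoid.End L) _ _ fun v => ?_
    rw [operator_sub, operator_X_pow, operator_one, hσ]
    exact sub_self v
  have hrel : f - h ∈ TwoSidedIdeal.span {X σ ^ n - 1} :=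
    (TwoSidedIdeal.rel_iff _ _ _).mp ((RingCon.eq _).mp hfh)
  have := (TwoSidedIdeal.mem_ker _).mp (hle hrel)
  rwa [map_sub, sub_eq_zero] at this

/-- The operator of `x - σⁱ(α⁻¹ σ(α))` kills `σⁱ(α)`, hence so do the operators of its left
multiples and those of the codewords. -/
theorem sum_mul_eq_zero_of_mem_skewCode {σ : RingAut L} {n : ℕ} (hσ : σ ^ n = 1) {α : L}
    (hα : α ≠ 0) {k : ℕ} {g : SkewPoly σ}
    (hg : IsLCLM g fun i : Fin k => X σ - C σ ((σ ^ (i : ℕ)) (α⁻¹ * σ α)))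
    {c : Fin n → L} (hc : c ∈ skewCode σ n g) {i : ℕ} (hi : i < k) :
    ∑ j : Fin n, c j * (σ ^ (i + j)) α = 0 := by
  have hroot : operator σ (X σ - C σ ((σ ^ i) (α⁻¹ * σ α))) ((σ ^ i) α) = 0 := by
    have h1 : operator σ (X σ) ((σ ^ i) α) = σ ((σ ^ i) α) := by simp [X, operator_monom]
    have h2 : (σ ^ i) (σ α) = σ ((σ ^ i) α) := by
      rw [← RingAut.mul_apply, ← RingAut.mul_apply, ← pow_succ, ← pow_succ']
    rw [operator_sub, h1, C, operator_monom, map_mul, h2, map_inv₀, pow_zero,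
      RingAut.one_apply, mul_right_comm, inv_mul_cancel₀ ((map_ne_zero _).mpr hα), one_mul, sub_self]
  obtain ⟨q, hq⟩ : ∃ q, q * (X σ - C σ ((σ ^ i) (α⁻¹ * σ α))) = g := by
    have hmem : g ∈ Ideal.span {g} := Ideal.subset_span rfl
    rw [show Ideal.span {g} = _ from hg, Submodule.mem_iInf] at hmem
    exact Ideal.mem_span_singleton'.mp (hmem ⟨i, hi⟩)
  obtain ⟨a, ha⟩ := Ideal.mem_span_singleton'.mp
    (show ofVec σ n c ∈ Ideal.span {toQuot σ n g} from hc)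
  obtain ⟨a, rfl⟩ := RingCon.mk'_surjective _ a
  have heq : toQuot σ n (a * g) = toQuot σ n (∑ i : Fin n, monom σ i (c i)) := by
    rw [map_mul]; exact ha
  have h := DFunLike.congr_fun (operator_eq_of_toQuot_eq hσ heq) ((σ ^ i) α)
  let ev : SkewPoly σ →+ L :=
    (AddMonoidHom.eval ((σ ^ i) α) : (L →+ L) →+ L).comp (operator σ).toAddMonoidHom
  have hsum : operator σ (∑ j : Fin n, monom σ j (c j)) ((σ ^ i) α) =
      ∑ j : Fin n, operator σ (monom σ j (c j)) ((σ ^ i) α) :=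
    map_sum ev _ _
  rw [← hq, operator_mul, operator_mul, hroot, map_zero, map_zero, hsum] at h
  rw [h]
  refine Finset.sum_congr rfl fun j _ => ?_
  rw [operator_monom, ← RingAut.mul_apply, ← pow_add, add_comm]

end SkewRS

/-! ### Sequences that obey a semilinear recurrence -/

namespace SkewRS

variable {L : Type*} [Field L]

/-- Suppose that applying a fixed semilinear map moves each term of `b` to the next one, so that a
relation which expresses `b m` through earlier terms can be shifted. Once a term is a combination
of its predecessors, all later ones are, so the first `d` terms span everything as soon as `d` is at
least the dimension of the span. -/
theorem mem_span_of_semilinear_recurrence {V : Type*} [AddCommGroup V] [Module L V]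
    [FiniteDimensional L V] (b : ℕ → V) (τ : L → L)
    (hb : ∀ (m r : ℕ) (a : Fin r → L), b m = ∑ i : Fin r, a i • b i →
      b (m + 1) = ∑ i : Fin r, τ (a i) • b (i + 1))
    {d : ℕ} (hd : Module.finrank L (Submodule.span L (Set.range b)) ≤ d) (m : ℕ) :
    b m ∈ Submodule.span L (Set.range fun i : Fin d => b i) := by
  set W : ℕ → Submodule L V := fun r => Submodule.span L (Set.range fun i : Fin r => b i) with hW
  have hmem : ∀ {i r : ℕ}, i < r → b i ∈ W r := fun {i r} h =>
    Submodule.subset_span ⟨⟨i, h⟩, rfl⟩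
  have hmono : ∀ {r r' : ℕ}, r ≤ r' → W r ≤ W r' := fun h => by
    rw [hW, Submodule.span_le]
    rintro _ ⟨i, rfl⟩
    exact hmem (i.2.trans_le h)
  obtain ⟨r, hr, hbr⟩ : ∃ r ≤ d, b r ∈ W r := by
    by_contra! hcon
    -- Otherwise the first `d + 1` terms would be linearly independent.
    have hrank : ∀ r ≤ d + 1, r ≤ Module.finrank L (W r) := by
      intro r
      induction r with
      | zero => simp
      | succ r ih =>
        intro hr
        have hlt : W r < W (r + 1) := lt_of_le_of_ne (hmono (Nat.le_succ r)) fun h =>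
          hcon r (by omega) (h ▸ hmem (Nat.lt_succ_self r))
        have := Submodule.finrank_lt_finrank_of_lt hlt
        have := ih (by omega)
        omega
    have hle : W (d + 1) ≤ Submodule.span L (Set.range b) := Submodule.span_mono <| by
      rintro _ ⟨i, rfl⟩
      exact ⟨i, rfl⟩
    have := Submodule.finrank_mono hle
    have := hrank _ le_rfl
    omega
  suffices h : ∀ k, b (r + k) ∈ W r by
    rcases lt_or_ge m r with hm | hm
    · exact hmono hr (hmem hm)
    · obtain ⟨k, rfl⟩ := Nat.exists_eq_add_of_le hm
      exact hmono hr (h k)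
  intro k
  induction k with
  | zero => exact hbr
  | succ k ih =>
    obtain ⟨a, ha⟩ := (Submodule.mem_span_range_iff_exists_fun L).mp ih
    rw [← add_assoc, hb _ r a ha.symm]
    refine sum_mem fun i _ => Submodule.smul_mem _ _ ?_
    rcases (Nat.succ_le_of_lt i.2).lt_or_eq with hi | hi
    · exact hmem hi
    · have : (i : ℕ) + 1 = r := hi
      rw [this]; exact hbr

/-! ### Matrices of conjugates -/

variable {n : ℕ}

/-- The linear form `v ↦ ∑ₖ vₖ σ^(i + k)(α)`. Up to the factor `σⁱ(α)` it is the `i`-th syndrome. -/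
def conjSum (σ : RingAut L) (α : L) (n i : ℕ) : (Fin n → L) →ₗ[L] L :=
  ∑ k : Fin n, (σ ^ (i + k)) α • LinearMap.proj k

theorem conjSum_apply (σ : RingAut L) (α : L) (i : ℕ) (v : Fin n → L) :
    conjSum σ α n i v = ∑ k : Fin n, v k * (σ ^ (i + k)) α := by
  simp [conjSum, mul_comm]

theorem conjSum_succ (σ : RingAut L) (α : L) (i : ℕ) (v : Fin n → L) :
    conjSum σ α n (i + 1) v = σ (conjSum σ α n i fun k => σ⁻¹ (v k)) := by
  simp only [conjSum_apply, map_sum, map_mul]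
  refine Finset.sum_congr rfl fun k _ => ?_
  rw [← RingAut.mul_apply, ← RingAut.mul_apply, mul_inv_cancel, ← pow_succ', add_right_comm,
    RingAut.one_apply]

theorem IsNormalBasisGenerator.ne_zero {σ : RingAut L} {α : L}
    (hα : IsNormalBasisGenerator σ n α) (hn : 0 < n) : α ≠ 0 := by
  obtain ⟨b, hb⟩ := hα
  have := b.ne_zero ⟨0, hn⟩
  rw [hb] at this
  simpa using this

/-- The matrix with entries `σ^(i + k)(α)`. -/
def conjMatrix (σ : RingAut L) (α : L) (n : ℕ) : Matrix (Fin n) (Fin n) L :=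
  Matrix.of fun i k => (σ ^ ((i : ℕ) + k)) α

/-- The matrix of conjugates of a normal basis is invertible: a relation between its rows is a
relation `∑ᵢ aᵢ σⁱ = 0` on the basis, hence on `L`, which contradicts the independence of
characters. -/
theorem isUnit_conjMatrix {σ : RingAut L} (hn : orderOf σ = n) {α : L}
    (hα : IsNormalBasisGenerator σ n α) : IsUnit (conjMatrix σ α n) := by
  rw [← Matrix.vecMul_injective_iff_isUnit]
  refine (injective_iff_map_eq_zero (Matrix.vecMulLinear (conjMatrix σ α n))).mpr fun a ha => ?_
  obtain ⟨b, hb⟩ := hα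
  have hinj : Function.Injective fun i : Fin n => ((σ ^ (i : ℕ) : RingAut L) : L →* L) := by
    intro i j hij
    have h : σ ^ (i : ℕ) = σ ^ (j : ℕ) := RingEquiv.ext fun x => DFunLike.congr_fun hij x
    exact Fin.ext (pow_injOn_Iio_orderOf (hn ▸ i.2) (hn ▸ j.2) h)
  have hli := Fintype.linearIndependent_iff.mp ((linearIndependent_monoidHom L L).comp _ hinj)
  ext i
  refine hli a (funext fun x => ?_) i
  have hfix : ∀ (c : invariantSubfield σ) (j : ℕ), (σ ^ j) (c : L) = c := by
    intro c j
    induction j with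
    | zero => simp
    | succ j ih =>
      rw [pow_succ, RingAut.mul_apply, show σ (c : L) = c from c.2, ih]
  have hb0 : ∀ k : Fin n, ∑ j : Fin n, a j * (σ ^ (j : ℕ)) (b k) = 0 := by
    intro k
    have := congrFun ha k
    simp only [Matrix.vecMulLinear_apply, Matrix.vecMul, dotProduct, conjMatrix, Matrix.of_apply,
      Pi.zero_apply] at this
    rw [← this]
    refine Finset.sum_congr rfl fun j _ => ?_
    rw [hb, ← RingAut.mul_apply, ← pow_add]
  have hx : ∑ j : Fin n, a j * (σ ^ (j : ℕ)) x = 0 := by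
    rw [← b.sum_repr x]
    simp only [map_sum, Subfield.smul_def, smul_eq_mul, map_mul, hfix, Finset.mul_sum]
    rw [Finset.sum_comm]
    refine Finset.sum_eq_zero fun k _ => ?_
    rw [← mul_zero (b.repr x k : L), ← hb0 k, Finset.mul_sum]
    exact Finset.sum_congr rfl fun j _ => mul_left_comm _ _ _
  simpa [Finset.sum_apply] using hx

/-- On a `σ⁻¹`-stable space `U`, the forms `conjSum σ α n i` obey a semilinear recurrence, and all
of them together separate vectors. So the first `dim U` of them already separate the vectors
of `U`. -/
theorem eq_zero_of_conjSum_eq_zero {σ : RingAut L} (hn : orderOf σ = n) {α : L}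
    (hα : IsNormalBasisGenerator σ n α) {U : Submodule L (Fin n → L)}
    (hU : ∀ u ∈ U, (fun k => σ⁻¹ (u k)) ∈ U) {d : ℕ} (hd : Module.finrank L U ≤ d)
    {u : Fin n → L} (hu : u ∈ U) (h : ∀ i < d, conjSum σ α n i u = 0) : u = 0 := by
  set p : ℕ → Module.Dual L U := fun i => (conjSum σ α n i).domRestrict U with hp
  have hrec : ∀ (m r : ℕ) (a : Fin r → L), p m = ∑ i : Fin r, a i • p i →
      p (m + 1) = ∑ i : Fin r, σ (a i) • p (i + 1) := by
    intro m r a ham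
    ext ⟨v, hv⟩
    have := DFunLike.congr_fun ham ⟨_, hU v hv⟩
    simp only [hp, LinearMap.domRestrict_apply, LinearMap.sum_apply, LinearMap.smul_apply,
      smul_eq_mul] at this ⊢
    rw [conjSum_succ, this, map_sum]
    exact Finset.sum_congr rfl fun i _ => by rw [map_mul, conjSum_succ]
  have hrank : Module.finrank L (Submodule.span L (Set.range p)) ≤ d :=
    (Submodule.finrank_le _).trans ((Subspace.dual_finrank_eq).trans_le hd)
  have hall : ∀ i, conjSum σ α n i u = 0 := by
    intro i
    have hle : Submodule.span L (Set.range fun i : Fin d => p i) ≤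
        LinearMap.ker (Module.Dual.eval L U ⟨u, hu⟩) := by
      rw [Submodule.span_le]
      rintro _ ⟨j, rfl⟩
      exact h j j.2
    exact hle (mem_span_of_semilinear_recurrence p σ hrec hrank i)
  apply Matrix.mulVec_injective_iff_isUnit.mpr (isUnit_conjMatrix hn hα)
  ext i
  rw [Matrix.mulVec_zero, Pi.zero_apply, ← hall i, conjSum_apply]
  simp only [Matrix.mulVec, dotProduct, conjMatrix, Matrix.of_apply, mul_comm]

/-- The space of the vectors that vanish outside `I`. -/
def supportedOn (L : Type*) [Field L] (I : Finset (Fin n)) : Submodule L (Fin n → L) where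
  carrier := {v | ∀ k ∉ I, v k = 0}
  add_mem' := fun hv hw k hk => by simp [hv k hk, hw k hk]
  zero_mem' := fun _ _ => rfl
  smul_mem' := fun a v hv k hk => by simp [hv k hk]

theorem finrank_supportedOn (I : Finset (Fin n)) :
    Module.finrank L (supportedOn L I) = I.card := by
  let f : supportedOn L I →ₗ[L] (I → L) :=
    LinearMap.funLeft L L Subtype.val ∘ₗ (supportedOn L I).subtype
  have hinj : Function.Injective f := by
    rw [injective_iff_map_eq_zero]
    rintro ⟨u, hu⟩ h
    ext k
    by_cases hk : k ∈ I
    · exact congrFun h ⟨k, hk⟩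
    · exact hu k hk
  have hsurj : Function.Surjective f := by
    intro w
    refine ⟨⟨fun k => if hk : k ∈ I then w ⟨k, hk⟩ else 0, fun k hk => dif_neg hk⟩, ?_⟩
    ext k
    exact dif_pos k.2
  simpa using (LinearEquiv.ofBijective f ⟨hinj, hsurj⟩).finrank_eq

/-- The square matrix with entries `σ^(kⱼ + i)(α)` is invertible for distinct positions `kⱼ`. -/
theorem isUnit_conjMatrix_positions {σ : RingAut L} (hn : orderOf σ = n) {α : L}
    (hα : IsNormalBasisGenerator σ n α) {ν : ℕ} {κ : Fin ν → Fin n} (hκ : Function.Injective κ) :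
    IsUnit (Matrix.of fun i j : Fin ν => (σ ^ ((κ j : ℕ) + (i : ℕ))) α) := by
  rw [← Matrix.mulVec_injective_iff_isUnit]
  refine (injective_iff_map_eq_zero (Matrix.mulVecLin _)).mpr fun x hx => ?_
  let U := supportedOn L (Finset.univ.image κ)
  have hUrank : Module.finrank L U ≤ ν := by
    rw [finrank_supportedOn]
    simpa using Finset.card_image_le (s := (Finset.univ : Finset (Fin ν))) (f := κ)
  let v : Fin n → L := ∑ j, Pi.single (κ j) (x j)
  have hv : v ∈ U := by
    refine sum_mem fun j _ k hk => ?_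
    rw [Pi.single_eq_of_ne]
    rintro rfl
    exact hk (Finset.mem_image_of_mem _ (Finset.mem_univ j))
  have hv0 : v = 0 := by
    refine eq_zero_of_conjSum_eq_zero hn hα (U := U) (fun u hu k hk => ?_) hUrank hv fun i hi => ?_
    · simp [hu k hk]
    · have := congrFun hx ⟨i, hi⟩
      simp only [Matrix.mulVecLin_apply, Matrix.mulVec, dotProduct, Matrix.of_apply,
        Pi.zero_apply] at this
      rw [← this, map_sum]
      refine Finset.sum_congr rfl fun j _ => ?_
      rw [conjSum_apply, Finset.sum_eq_single (κ j)]
      · rw [Pi.single_eq_same, mul_comm, add_comm]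
      · intro k _ hk
        rw [Pi.single_eq_of_ne hk, zero_mul]
      · simp
  ext j
  have : v (κ j) = x j := by
    simp only [v, Finset.sum_apply]
    rw [Finset.sum_eq_single j]
    · simp
    · intro j' _ hj'
      exact Pi.single_eq_of_ne (fun h => hj' (hκ h).symm) _
    · simp
  rw [← this, hv0]
  rfl

/-! ### The space spanned by the conjugates of a vector -/

/-- The space spanned by the vectors that arise from `e` by applying a power of `σ⁻¹` to all
coordinates. -/
def conjSpan (σ : RingAut L) (e : Fin n → L) : Submodule L (Fin n → L) :=
  Submodule.span L (Set.range fun (j : ℕ) k => (σ ^ j)⁻¹ (e k))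

theorem mem_conjSpan_self (σ : RingAut L) (e : Fin n → L) : e ∈ conjSpan σ e :=
  Submodule.subset_span ⟨0, by simp⟩

theorem inv_pow_succ_apply (σ : RingAut L) (j : ℕ) (a : L) :
    (σ ^ (j + 1))⁻¹ a = σ⁻¹ ((σ ^ j)⁻¹ a) := by
  rw [pow_succ, mul_inv_rev, RingAut.mul_apply]

theorem inv_mem_conjSpan {σ : RingAut L} {e u : Fin n → L} (hu : u ∈ conjSpan σ e) :
    (fun k => σ⁻¹ (u k)) ∈ conjSpan σ e := by
  induction hu using Submodule.span_induction with
  | mem u hu =>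
    obtain ⟨j, rfl⟩ := hu
    exact Submodule.subset_span ⟨j + 1, funext fun k => inv_pow_succ_apply σ j (e k)⟩
  | zero => convert zero_mem (conjSpan σ e); simp
  | add u v _ _ hu hv => convert add_mem hu hv; simp
  | smul a u _ hu =>
    convert Submodule.smul_mem _ (σ⁻¹ a) hu
    simp

theorem conjSpan_le_supportedOn (σ : RingAut L) {e : Fin n → L} {I : Finset (Fin n)}
    (hI : ∀ k ∉ I, e k = 0) : conjSpan σ e ≤ supportedOn L I := by
  rw [conjSpan, Submodule.span_le]
  rintro _ ⟨j, rfl⟩ k hk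
  simp [hI k hk]

theorem conjSpan_eq_span_of_finrank_le (σ : RingAut L) (e : Fin n → L) {t : ℕ}
    (ht : Module.finrank L (conjSpan σ e) ≤ t) :
    conjSpan σ e = Submodule.span L (Set.range fun (j : Fin t) k => (σ ^ (j : ℕ))⁻¹ (e k)) := by
  apply le_antisymm
  · rw [conjSpan, Submodule.span_le]
    rintro _ ⟨j, rfl⟩
    refine mem_span_of_semilinear_recurrence (fun (j : ℕ) k => (σ ^ j)⁻¹ (e k)) (σ⁻¹ : RingAut L)
      (fun m r a h => ?_) ht j
    ext k
    have := congrFun h k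
    simp only [Finset.sum_apply, Pi.smul_apply, smul_eq_mul] at this
    simp only [inv_pow_succ_apply, this, map_sum, map_mul, Finset.sum_apply, Pi.smul_apply,
      smul_eq_mul]
  · refine Submodule.span_mono ?_
    rintro _ ⟨j, rfl⟩
    exact ⟨j, rfl⟩

end SkewRS

/-! ### Detecting canonical vectors by orthogonality -/

namespace SkewRS

variable {L : Type*} [Field L] {n : ℕ}

/-- If the spaces `Q = span (range q)` and `U` are orthogonal with respect to a nondegenerate diagonal
form and have complementary dimensions, then each is the orthogonal space of the other, so a
canonical vector lies in `Q` if and only if the corresponding coordinate vanishes on `U`. -/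
theorem single_mem_span_iff_of_orthogonal {ι : Type*} {w : Fin n → L} (hw : ∀ d, w d ≠ 0)
    {q : ι → Fin n → L} {U : Submodule L (Fin n → L)}
    (hdim : Module.finrank L (Submodule.span L (Set.range q)) + Module.finrank L U = n)
    (horth : ∀ i, ∀ u ∈ U, ∑ d, q i d * w d * u d = 0) (d : Fin n) :
    Pi.single d 1 ∈ Submodule.span L (Set.range q) ↔ ∀ u ∈ U, u d = 0 := by
  let T : (Fin n → L) →ₗ[L] Module.Dual L (Fin n → L) :=
    ∑ d, (LinearMap.proj d : (Fin n → L) →ₗ[L] L).smulRight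
      (w d • (LinearMap.proj d : (Fin n → L) →ₗ[L] L))
  have hT : ∀ q u, T q u = ∑ d, q d * w d * u d := fun q u => by
    simp [T, LinearMap.sum_apply, mul_assoc]
  have hTs : ∀ u, T (Pi.single d 1) u = w d * u d := fun u => by
    rw [hT, Finset.sum_eq_single d]
    · simp
    · intro j _ hj
      rw [Pi.single_eq_of_ne hj, zero_mul, zero_mul]
    · simp
  have hinj : Function.Injective T := by
    rw [injective_iff_map_eq_zero]
    intro q hq
    ext j
    have := DFunLike.congr_fun hq (Pi.single j 1)
    rw [hT, Finset.sum_eq_single j] at this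
    · simpa [hw j] using this
    · intro k _ hk
      rw [Pi.single_eq_of_ne hk, mul_zero]
    · simp
  set Q := Submodule.span L (Set.range q)
  have heq : Q.map T = U.dualAnnihilator := by
    apply Submodule.eq_of_le_of_finrank_eq
    · rw [Submodule.map_le_iff_le_comap, Submodule.span_le]
      rintro _ ⟨i, rfl⟩
      rw [SetLike.mem_coe, Submodule.mem_comap, Submodule.mem_dualAnnihilator]
      intro u hu
      rw [hT, horth i u hu]
    · have h := Subspace.finrank_add_finrank_dualAnnihilator_eq U
      rw [Module.finrank_fin_fun] at h
      rw [← (Submodule.equivMapOfInjective T hinj Q).finrank_eq]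
      omega
  rw [← SetLike.mem_coe, ← hinj.mem_set_image, ← Submodule.map_coe, heq, SetLike.mem_coe,
    Submodule.mem_dualAnnihilator]
  simp [hTs, hw d]

/-! ### The error positions -/

theorem skewNorm_eq (σ : RingAut L) {α : L} (hα : α ≠ 0) (d j : ℕ) :
    skewNorm σ j ((σ ^ d) (α⁻¹ * σ α)) = (σ ^ (d + j)) α * ((σ ^ d) α)⁻¹ := by
  have h0 : ∀ i, (σ ^ i) α ≠ 0 := fun i => (map_ne_zero _).mpr hα
  induction j with
  | zero => rw [add_zero, mul_inv_cancel₀ (h0 d)]; simp [skewNorm]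
  | succ j ih =>
    have h1 : (σ ^ j) ((σ ^ d) (σ α)) = (σ ^ (d + (j + 1))) α := by
      rw [← add_assoc, add_comm d j, pow_succ, pow_add]; rfl
    have h2 : (σ ^ j) ((σ ^ d) α) = (σ ^ (d + j)) α := by
      rw [add_comm, pow_add]; rfl
    rw [skewNorm, Finset.prod_range_succ, ← skewNorm, ih, map_mul, map_mul, h1, map_inv₀, map_inv₀,
      h2]
    have := h0 (d + j)
    field_simp

/-- A sum against a sequence that is shifted by `i` and supported in `[0, μ]`. -/
theorem sum_fin_shift (f h : ℕ → L) {μ i : ℕ} (hi : i + μ < n) (hf : ∀ l, μ < l → f l = 0) :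
    ∑ j : Fin n, (if i ≤ (j : ℕ) then f (j - i) else 0) * h j =
      ∑ l ∈ Finset.range (μ + 1), f l * h (i + l) := by
  rw [Fin.sum_univ_eq_sum_range fun j => (if i ≤ j then f (j - i) else 0) * h j]
  obtain ⟨k, rfl⟩ : ∃ k, n = i + (μ + 1 + k) := ⟨n - (i + μ + 1), by omega⟩
  rw [Finset.sum_range_add, Finset.sum_eq_zero, zero_add, Finset.sum_range_add _ (μ + 1) k,
    add_eq_left.mpr]
  · exact Finset.sum_congr rfl fun l _ => by simp
  · exact Finset.sum_eq_zero fun l _ => by rw [if_pos (by omega), hf _ (by omega), zero_mul]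
  · intro j hj
    rw [if_neg (by simpa using hj), zero_mul]

end SkewRS

namespace PGZ

open SkewRS

variable {L : Type*} [Field L] {n : ℕ}

/-- The value at `σᵈ(α)` of the operator `∑ ρₗ σˡ` of the skew polynomial `ρ` of degree at
most `μ`. -/
def rhoValue (σ : RingAut L) (α : L) (μ : ℕ) (ρ : ℕ → L) (d : ℕ) : L :=
  ∑ l ∈ Finset.range (μ + 1), ρ l * (σ ^ (d + l)) α

theorem vecMul_normMatrix (σ : RingAut L) {α : L} (hα : α ≠ 0) {μ : ℕ} {ρ : ℕ → L} (hμ : μ < n)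
    (hρ : ∀ l, μ < l → ρ l = 0) (d : Fin n) :
    Matrix.vecMul (fun i : Fin n => ρ i) (normMatrix σ α n) d =
      rhoValue σ α μ ρ d * ((σ ^ (d : ℕ)) α)⁻¹ := by
  have := sum_fin_shift ρ (fun j => skewNorm σ j ((σ ^ (d : ℕ)) (α⁻¹ * σ α))) (n := n) (i := 0)
    (by omega) hρ
  simp only [Nat.zero_le, if_true, Nat.sub_zero, zero_add, skewNorm_eq σ hα] at this
  simp only [Matrix.vecMul, dotProduct, normMatrix, Matrix.of_apply, skewNorm_eq σ hα]
  rw [this, rhoValue, Finset.sum_mul]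
  exact Finset.sum_congr rfl fun l _ => (mul_assoc _ _ _).symm

/-- The rows of `M_ρ N` hold, up to a diagonal scaling, the values of the multiples `xⁱ ρ`. -/
theorem multMatrix_mul_normMatrix (σ : RingAut L) {α : L} (hα : α ≠ 0) {μ : ℕ} {ρ : ℕ → L}
    (hρ : ∀ l, μ < l → ρ l = 0) (i : Fin (n - μ)) (d : Fin n) :
    (multMatrix σ n μ ρ * normMatrix σ α n) i d =
      (σ ^ (i : ℕ)) (rhoValue σ α μ ρ d) * ((σ ^ (d : ℕ)) α)⁻¹ := by
  have := sum_fin_shift (fun l => (σ ^ (i : ℕ)) (ρ l))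
    (fun j => skewNorm σ j ((σ ^ (d : ℕ)) (α⁻¹ * σ α))) (n := n) (i := i) (μ := μ)
    (by omega) (fun l hl => by simp [hρ l hl])
  simp only [Matrix.mul_apply, multMatrix, normMatrix, Matrix.of_apply]
  rw [this, rhoValue, map_sum, Finset.sum_mul]
  refine Finset.sum_congr rfl fun l _ => ?_
  rw [skewNorm_eq σ hα, map_mul, ← RingAut.mul_apply, ← pow_add, mul_assoc]
  congr 4
  omega

theorem isUnit_normMatrix {σ : RingAut L} (hn : orderOf σ = n) {α : L}
    (hα : IsNormalBasisGenerator σ n α) (hα0 : α ≠ 0) : IsUnit (normMatrix σ α n) := by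
  have h : normMatrix σ α n =
      conjMatrix σ α n * Matrix.diagonal fun d : Fin n => ((σ ^ (d : ℕ)) α)⁻¹ := by
    ext i d
    rw [Matrix.mul_diagonal, normMatrix, Matrix.of_apply, skewNorm_eq σ hα0, conjMatrix,
      Matrix.of_apply, add_comm]
  rw [h]
  refine (isUnit_conjMatrix hn hα).mul ?_
  rw [Matrix.isUnit_diagonal, Pi.isUnit_iff]
  intro d
  exact (inv_ne_zero ((map_ne_zero _).mpr hα0)).isUnit

/-- If `ρ` is monic of degree `μ`, then `M_ρ` is in echelon form without zero rows, and multiplication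
by the invertible matrix `N` preserves its rank. -/
theorem finrank_span_multMatrix_mul_normMatrix {σ : RingAut L} (hn : orderOf σ = n) {α : L}
    (hα : IsNormalBasisGenerator σ n α) (hα0 : α ≠ 0) {μ : ℕ} {ρ : ℕ → L} (hρ1 : ρ μ = 1)
    (hρ : ∀ l, μ < l → ρ l = 0) :
    Module.finrank L (Submodule.span L
      (Set.range (multMatrix σ n μ ρ * normMatrix σ α n))) = n - μ := by
  -- The columns from the `μ`-th on form a unitriangular matrix.
  let B : Matrix (Fin (n - μ)) (Fin (n - μ)) L :=
    Matrix.of fun i j => multMatrix σ n μ ρ i ⟨j + μ, by omega⟩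
  have hB : IsUnit B := by
    rw [Matrix.isUnit_iff_isUnit_det, Matrix.det_of_isLowerTriangular]
    · simp [B, multMatrix, hρ1, Finset.prod_eq_one]
    · intro i j hij
      have hij : (i : ℕ) < j := hij
      simp only [B, multMatrix, Matrix.of_apply]
      rw [if_pos (by omega), hρ _ (by omega), map_zero]
  have hli : LinearIndependent L (multMatrix σ n μ ρ * normMatrix σ α n).row := by
    rw [← Matrix.vecMul_injective_iff]
    intro a a' h
    simp only [← Matrix.vecMul_vecMul] at h
    have h := Matrix.vecMul_injective_iff_isUnit.mpr (isUnit_normMatrix hn hα hα0) h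
    apply Matrix.vecMul_injective_iff_isUnit.mpr hB
    ext j
    exact congrFun h ⟨j + μ, by omega⟩
  exact (finrank_span_eq_card hli).trans (Fintype.card_fin _)

variable [DecidableEq L]

/-- Let `ρ` be monic of degree `μ = dim U` and suppose that its values are orthogonal to `U`. The row
space `Q` of `M_ρ N` is then the orthogonal space of `U`, whose canonical vectors are those of the
coordinates that vanish on `U`. If `ρ N` has exactly `μ` zero coordinates, then `Q` is also the
orthogonal space of the vectors supported there, so these are the remaining coordinates. -/
theorem errorPositions_eq {σ : RingAut L} (hn : orderOf σ = n) {α : L}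
    (hα : IsNormalBasisGenerator σ n α) {U : Submodule L (Fin n → L)}
    (hU : ∀ u ∈ U, (fun k => σ⁻¹ (u k)) ∈ U) {μ : ℕ} (hUμ : Module.finrank L U = μ) (hμ : μ < n)
    {ρ : ℕ → L} (hρ1 : ρ μ = 1) (hρ : ∀ l, μ < l → ρ l = 0)
    (horth : ∀ u ∈ U, ∑ l ∈ Finset.range (μ + 1), ρ l * conjSum σ α n l u = 0)
    {e : Fin n → L} (he : ∀ d, (∀ u ∈ U, u d = 0) ↔ e d = 0) :
    errorPositions σ α n μ ρ = (List.finRange n).filter fun d => e d ≠ 0 := by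
  have hα0 : α ≠ 0 := hα.ne_zero (by omega)
  have hpow : ∀ d : Fin n, (σ ^ (d : ℕ)) α ≠ 0 := fun d => (map_ne_zero _).mpr hα0
  set Q := Submodule.span L (Set.range (multMatrix σ n μ ρ * normMatrix σ α n)) with hQ
  have hQrank : Module.finrank L Q = n - μ :=
    finrank_span_multMatrix_mul_normMatrix hn hα hα0 hρ1 hρ
  have hrow : ∀ (i : Fin (n - μ)) (u : Fin n → L),
      ∑ d, (multMatrix σ n μ ρ * normMatrix σ α n) i d * (σ ^ (d : ℕ)) α * u d =
        ∑ d : Fin n, (σ ^ (i : ℕ)) (rhoValue σ α μ ρ d) * u d := fun i u =>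
    Finset.sum_congr rfl fun d _ => by
      rw [multMatrix_mul_normMatrix σ hα0 hρ, inv_mul_cancel_right₀ (hpow d)]
  -- The values of every multiple `xⁱ ρ` are orthogonal to `U`, by the stability of `U` under `σ⁻¹`.
  have hzero : ∀ (i : ℕ), ∀ u ∈ U, ∑ d : Fin n, (σ ^ i) (rhoValue σ α μ ρ d) * u d = 0 := by
    intro i
    induction i with
    | zero =>
      intro u hu
      rw [← horth u hu]
      simp only [pow_zero, RingAut.one_apply, rhoValue, conjSum_apply, Finset.sum_mul,
        Finset.mul_sum]
      rw [Finset.sum_comm]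
      refine Finset.sum_congr rfl fun l _ => Finset.sum_congr rfl fun d _ => ?_
      rw [add_comm l]
      ring
    | succ i ih =>
      intro u hu
      have h := congrArg σ (ih _ (hU u hu))
      simp only [map_sum, map_mul, map_zero] at h
      rw [← h]
      refine Finset.sum_congr rfl fun d _ => ?_
      rw [pow_succ', RingAut.mul_apply, ← RingAut.mul_apply σ σ⁻¹, mul_inv_cancel,
        RingAut.one_apply]
  have hsingle : ∀ (V : Submodule L (Fin n → L)), Module.finrank L V = μ →
      (∀ (i : Fin (n - μ)), ∀ u ∈ V,
        ∑ d : Fin n, (σ ^ (i : ℕ)) (rhoValue σ α μ ρ d) * u d = 0) →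
      ∀ d, Pi.single d 1 ∈ Q ↔ ∀ u ∈ V, u d = 0 := fun V hV h d =>
    single_mem_span_iff_of_orthogonal hpow (by rw [← hQ, hQrank, hV]; omega)
      (fun i u hu => by rw [hrow, h i u hu]) d
  have hsupp : ∀ d, Pi.single d 1 ∈ Q ↔ e d = 0 := by
    intro d
    rw [← he]
    exact hsingle U hUμ (fun i => hzero i) d
  have hK : zeroCoords (Matrix.vecMul (fun i : Fin n => ρ i) (normMatrix σ α n)) =
      (List.finRange n).filter fun d : Fin n => rhoValue σ α μ ρ d = 0 := by
    refine List.filter_congr fun d _ => ?_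
    rw [decide_eq_decide, vecMul_normMatrix σ hα0 hμ hρ, mul_eq_zero, inv_eq_zero, or_iff_left (hpow d)]
  simp only [errorPositions]
  split_ifs with hlen
  · refine List.filter_congr fun d _ => ?_
    rw [decide_eq_decide, ← not_iff_not, not_not, ← hsupp, hQ,
      ← Gauss.exists_rref_row_eq_single_iff]
    simp only [canonicalRows, List.mem_filter, List.mem_map, List.mem_finRange, true_and,
      decide_eq_true_eq, not_forall, exists_prop]
    constructor
    · rintro ⟨v, ⟨⟨i, hi⟩, d', rfl⟩, hv⟩
      obtain rfl : d = d' := by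
        by_contra hne
        exact hv (Pi.single_eq_of_ne hne _)
      exact ⟨i, hi⟩
    · rintro ⟨i, hi⟩
      exact ⟨_, ⟨⟨i, hi⟩, d, rfl⟩, by simp⟩
  · rw [hK]
    refine List.filter_congr fun d _ => ?_
    rw [decide_eq_decide, ← not_iff_not, not_not, ← hsupp]
    set Z : Finset (Fin n) := Finset.univ.filter fun d => rhoValue σ α μ ρ d = 0 with hZ
    have hZcard : Z.card = μ := by
      rw [not_not, hK] at hlen
      rw [hlen, ← List.toFinset_card_of_nodup ((List.nodup_finRange n).filter _)]
      congr 1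
      ext d
      simp [hZ]
    rw [hsingle (supportedOn L Z) (by rw [finrank_supportedOn, hZcard])]
    · refine ⟨fun hd u hu => hu d (by simpa [hZ] using hd), fun h hd => ?_⟩
      have hmem : (Pi.single d 1 : Fin n → L) ∈ supportedOn L Z := fun k hk =>
        Pi.single_eq_of_ne (by rintro rfl; exact hk (by simpa [hZ] using hd)) _
      simpa using h _ hmem
    · intro i u hu
      refine Finset.sum_eq_zero fun d _ => ?_
      by_cases hd : d ∈ Z
      · rw [show rhoValue σ α μ ρ d = 0 by simpa [hZ] using hd, map_zero, zero_mul]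
      · rw [hu d hd, mul_zero]

end PGZ

/-! ### Syndromes -/

namespace PGZ

open SkewRS

variable {L : Type*} [Field L] {n : ℕ}

theorem syndrome_eq (σ : RingAut L) {α : L} (hα : α ≠ 0) (y : Fin n → L) (i : ℕ) :
    syndrome σ α y i = conjSum σ α n i y * ((σ ^ i) α)⁻¹ := by
  rw [syndrome, conjSum_apply, Finset.sum_mul]
  exact Finset.sum_congr rfl fun k _ => by rw [skewNorm_eq σ hα, mul_assoc]

/-- The `j`-th column of the syndrome matrix holds the values of the forms `conjSum σ α n i` at the
vector that arises from `e` by applying `σ⁻ʲ` to all coordinates. -/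
theorem syndromeMatrix_apply (σ : RingAut L) {α : L} (hα : α ≠ 0) {t : ℕ} {s : ℕ → L}
    {e : Fin n → L} (hs : ∀ i < 2 * t, s i = conjSum σ α n i e * ((σ ^ i) α)⁻¹)
    (i : Fin (t + 1)) (j : Fin t) :
    syndromeMatrix σ α t s i j = conjSum σ α n i fun k => (σ ^ (j : ℕ))⁻¹ (e k) := by
  have hinv : ∀ (m : ℕ) (x : L), (σ ^ (j : ℕ))⁻¹ ((σ ^ (m + j)) x) = (σ ^ m) x := by
    intro m x
    rw [← RingAut.mul_apply, add_comm, pow_add, inv_mul_cancel_left]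
  rw [syndromeMatrix, Matrix.of_apply, hs _ (by omega), map_mul, map_inv₀, hinv,
    inv_mul_cancel_right₀ ((map_ne_zero _).mpr hα), conjSum_apply, conjSum_apply, map_sum]
  refine Finset.sum_congr rfl fun k _ => ?_
  rw [map_mul, add_right_comm, hinv]

/-! ### The decoder -/

variable [DecidableEq L]

/-- If the column space of `S` has dimension `μ` and its vectors are determined by their first `μ`
coordinates, then the reduced column echelon form has the block form required by the decoder. -/
theorem hasIdentityBlock_rcef {t : ℕ} (S : Matrix (Fin (t + 1)) (Fin t) L) {μ : ℕ}
    (hrank : Module.finrank L (Submodule.span L (Set.range S.transpose)) = μ)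
    (hinj : ∀ v ∈ Submodule.span L (Set.range S.transpose),
      (∀ i : Fin (t + 1), (i : ℕ) < μ → v i = 0) → v = 0) :
    numNonzeroCols (Gauss.rcef S) = μ ∧ HasIdentityBlock (Gauss.rcef S) := by
  obtain ⟨hid, hzero⟩ := Gauss.rref_eq_identity_block S.transpose hrank hinj
  have hμt : μ ≤ t := by
    rw [← hrank]
    exact (finrank_range_le_card (R := L) S.transpose).trans_eq (Fintype.card_fin t)
  have hnum : numNonzeroCols (Gauss.rcef S) = μ := by
    have h : (Finset.univ.filter fun j : Fin t => ∃ i, Gauss.rcef S i j ≠ 0) =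
        Finset.univ.filter fun j : Fin t => (j : ℕ) < μ := by
      refine Finset.filter_congr fun j _ => ⟨fun ⟨i, hi⟩ => ?_, fun hj => ⟨j.castSucc, ?_⟩⟩
      · by_contra hj
        exact hi (congrFun (hzero j (not_lt.mp hj)) i)
      · have := hid j j.castSucc hj hj
        rw [Gauss.rcef, Matrix.transpose_apply, this]
        simp
    rw [numNonzeroCols, h, Fin.card_filter_val_lt, min_eq_right hμt]
  refine ⟨hnum, fun i j => ?_⟩
  rw [hnum]
  refine ⟨fun hi hj => ?_, fun hj => congrFun (hzero j hj) i⟩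
  rw [Gauss.rcef, Matrix.transpose_apply, hid j i hj hi]
  simp only [eq_comm]

/-- The coefficients of `ρ` annihilate the columns of the matrix from which they are read off. -/
theorem sum_rhoCoeff_mul_eq_zero {t : ℕ} {R : Matrix (Fin (t + 1)) (Fin t) L}
    (hR : HasIdentityBlock R) (j : Fin t) : ∑ k : Fin (t + 1), rhoCoeff R k * R k j = 0 := by
  by_cases hj : (j : ℕ) < numNonzeroCols R
  · have hle := numNonzeroCols_le R
    have hne : j.castSucc ≠ ⟨numNonzeroCols R, Nat.lt_succ_of_le hle⟩ := fun h => by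
      have := congrArg Fin.val h
      simp only [Fin.val_castSucc] at this
      omega
    rw [Finset.sum_eq_add j.castSucc ⟨numNonzeroCols R, Nat.lt_succ_of_le hle⟩ hne]
    · rw [((hR j.castSucc j).1 hj hj)]
      simp [rhoCoeff, hj]
    · rintro k - ⟨h1, h2⟩
      rw [Ne, Fin.ext_iff] at h1 h2
      by_cases hk : (k : ℕ) < numNonzeroCols R
      · rw [(hR k j).1 hk hj, if_neg (by simpa using h1), mul_zero]
      · rw [rhoCoeff, dif_neg hk, if_neg h2, zero_mul]
    · simp
    · simp
  · exact Finset.sum_eq_zero fun k _ => by rw [(hR k j).2 (not_lt.mp hj), mul_zero]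

theorem rhoCoeff_eq_zero_of_lt {t : ℕ} {R : Matrix (Fin (t + 1)) (Fin t) L} {k : ℕ}
    (hk : numNonzeroCols R < k) : rhoCoeff R k = 0 := by
  rw [rhoCoeff, dif_neg hk.not_gt, if_neg hk.ne']

theorem sum_rhoCoeff_rcef_mul_eq_zero {t : ℕ} {S : Matrix (Fin (t + 1)) (Fin t) L}
    (hS : HasIdentityBlock (Gauss.rcef S)) {v : Fin (t + 1) → L}
    (hv : v ∈ Submodule.span L (Set.range S.transpose)) :
    ∑ k : Fin (t + 1), rhoCoeff (Gauss.rcef S) k * v k = 0 := by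
  rw [← Gauss.span_rref] at hv
  obtain ⟨a, rfl⟩ := (Submodule.mem_span_range_iff_exists_fun L).mp hv
  simp only [Finset.sum_apply, Pi.smul_apply, smul_eq_mul, Finset.mul_sum]
  rw [Finset.sum_comm]
  refine Finset.sum_eq_zero fun j _ => ?_
  rw [← mul_zero (a j), ← sum_rhoCoeff_mul_eq_zero hS j, Finset.mul_sum]
  exact Finset.sum_congr rfl fun k _ => mul_left_comm _ _ _

/-- If the list of positions is the support of `e`, then the linear system has the nonzero
coordinates of `e` as its unique solution. -/
theorem errorVector_eq_some {σ : RingAut L} (hn : orderOf σ = n) {α : L}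
    (hα : IsNormalBasisGenerator σ n α) (hα0 : α ≠ 0) {s : ℕ → L} {e : Fin n → L} {K : List (Fin n)}
    (hK : K.Nodup) (hmem : ∀ k, k ∈ K ↔ e k ≠ 0)
    (hs : ∀ i < K.length, s i = conjSum σ α n i e * ((σ ^ i) α)⁻¹) :
    errorVector σ α s K = some e := by
  have hinj : Function.Injective K.get := List.nodup_iff_injective_get.mp hK
  have himage : ∀ f : Fin n → L, (∀ k, e k = 0 → f k = 0) → ∑ j, f (K.get j) = ∑ k, f k := by
    intro f hf
    rw [← Finset.sum_image (g := K.get) (f := f) fun a _ b _ h => hinj h]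
    refine Finset.sum_subset (Finset.subset_univ _) fun k _ hk => hf k ?_
    by_contra hek
    obtain ⟨j, hj⟩ := List.mem_iff_get.mp ((hmem k).mpr hek)
    exact hk (Finset.mem_image.mpr ⟨j, Finset.mem_univ _, hj⟩)
  rw [errorVector, Gauss.solve_eq_some (isUnit_conjMatrix_positions hn hα hinj)
    (x := fun j => e (K.get j))]
  · refine congrArg some (funext fun k => ?_)
    change ∑ j, (if K.get j = k then e (K.get j) else 0) = e k
    rw [himage fun k' => if k' = k then e k' else 0]
    · simp
    · intro k' hk'
      simp [hk']
  · ext i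
    rw [hs i i.2, mul_left_comm, mul_inv_cancel₀ ((map_ne_zero _).mpr hα0), mul_one,
      conjSum_apply, ← himage fun k => e k * (σ ^ ((i : ℕ) + k)) α]
    · simp only [Matrix.mulVec, dotProduct, Matrix.of_apply]
      exact Finset.sum_congr rfl fun j _ => by rw [mul_comm, add_comm]
    · intro k hk
      rw [hk, zero_mul]

/-- The decoder only sees the syndromes of `y`, so it finds `e` as soon as the first `2t` of them are
those of `e`. -/
theorem decode_eq_some {σ : RingAut L} (hn : orderOf σ = n) {α : L}
    (hα : IsNormalBasisGenerator σ n α) (hα0 : α ≠ 0) {δ : ℕ} (hδn : (δ - 1) / 2 < n)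
    {y e : Fin n → L}
    (hs : ∀ i < 2 * ((δ - 1) / 2), conjSum σ α n i y = conjSum σ α n i e)
    (he : (Finset.univ.filter fun i => e i ≠ 0).card ≤ (δ - 1) / 2) :
    decode σ α δ y = some e := by
  simp only [decode]
  set t := (δ - 1) / 2
  have hsyn : ∀ i < 2 * t, syndrome σ α y i = conjSum σ α n i e * ((σ ^ i) α)⁻¹ :=
    fun i hi => by rw [syndrome_eq σ hα0, hs i hi]
  set U := conjSpan σ e with hUdef
  have hU : ∀ u ∈ U, (fun k => σ⁻¹ (u k)) ∈ U := fun u hu => inv_mem_conjSpan hu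
  have hUsupp : U ≤ supportedOn L (Finset.univ.filter fun i => e i ≠ 0) :=
    conjSpan_le_supportedOn σ fun k hk => by simpa using hk
  set μ := Module.finrank L U with hμ
  have hμt : μ ≤ t := by
    have := Submodule.finrank_mono hUsupp
    rw [finrank_supportedOn] at this
    exact this.trans he
  have hsep : ∀ u ∈ U, (∀ i < μ, conjSum σ α n i u = 0) → u = 0 := fun u hu h =>
    eq_zero_of_conjSum_eq_zero hn hα hU le_rfl hu h
  split_ifs with h0 hblock
  · refine congrArg some (hsep e (mem_conjSpan_self σ e) fun i hi => ?_).symm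
    have h := h0 i (by omega)
    rw [hsyn i (by omega)] at h
    exact (mul_eq_zero.mp h).resolve_right (inv_ne_zero ((map_ne_zero _).mpr hα0))
  all_goals
    set S := syndromeMatrix σ α t (syndrome σ α y)
    -- `Φ` maps `U` isomorphically onto the column space of the syndrome matrix.
    let Φ : (Fin n → L) →ₗ[L] (Fin (t + 1) → L) := LinearMap.pi fun i => conjSum σ α n i
    have hspan : Submodule.span L (Set.range S.transpose) = U.map Φ := by
      rw [hUdef, conjSpan_eq_span_of_finrank_le σ e hμt, Submodule.map_span, ← Set.range_comp]
      congr 2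
      ext j i
      exact syndromeMatrix_apply σ hα0 hsyn i j
    have hrank : Module.finrank L (Submodule.span L (Set.range S.transpose)) = μ := by
      have hinj : Function.Injective (Φ.domRestrict U) := by
        rw [injective_iff_map_eq_zero]
        rintro ⟨u, hu⟩ h
        exact Subtype.ext (hsep u hu fun i hi => congrFun h ⟨i, by omega⟩)
      rw [hspan, ← LinearMap.range_domRestrict, LinearMap.finrank_range_of_inj hinj]
    obtain ⟨hnum, hblock'⟩ := hasIdentityBlock_rcef S hrank (by
      intro v hv h
      rw [hspan] at hv
      obtain ⟨u, hu, rfl⟩ := hv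
      rw [hsep u hu fun i hi => h ⟨i, by omega⟩ hi, map_zero])
  · rw [hnum, errorPositions_eq hn hα hU hμ.symm (by omega) (by simp [rhoCoeff, hnum])
      (fun l hl => rhoCoeff_eq_zero_of_lt (hnum.trans_lt hl)) ?_ (e := e)]
    · refine errorVector_eq_some hn hα hα0 ((List.nodup_finRange n).filter _) (by simp) ?_
      intro i hi
      refine hsyn i ?_
      rw [← List.toFinset_card_of_nodup ((List.nodup_finRange n).filter _)] at hi
      have hcard : (List.filter (fun d => decide (e d ≠ 0)) (List.finRange n)).toFinset =
          Finset.univ.filter fun i => e i ≠ 0 := by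
        ext d
        simp
      rw [hcard] at hi
      omega
    · exact fun d => ⟨fun h => h e (mem_conjSpan_self σ e), fun hd u hu =>
        hUsupp hu d (by simpa using hd)⟩
    · intro u hu
      have h := sum_rhoCoeff_rcef_mul_eq_zero hblock' (hspan ▸ Submodule.mem_map_of_mem hu)
      rw [← h]
      change _ = ∑ k : Fin (t + 1), rhoCoeff (Gauss.rcef S) k * conjSum σ α n k u
      rw [Fin.sum_univ_eq_sum_range fun k => rhoCoeff (Gauss.rcef S) k * conjSum σ α n k u]
      refine Finset.sum_subset (Finset.range_subset_range.mpr (by omega)) fun k _ hk => ?_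
      rw [Finset.mem_range, not_lt] at hk
      rw [rhoCoeff_eq_zero_of_lt (by omega), zero_mul]
  · exact absurd hblock' hblock

end PGZ

theorem mainTheorem1 {L : Type*} [Field L] [DecidableEq L] (σ : RingAut L) (n : ℕ)
    (hn : orderOf σ = n) (α : L) (hα : SkewRS.IsNormalBasisGenerator σ n α)
    (δ : ℕ) (hδ : 2 ≤ δ) (hδn : δ ≤ n)
    (g : SkewRS.SkewPoly σ)
    (hg : SkewRS.IsLCLM g fun i : Fin (δ - 1) =>
      SkewRS.X σ - SkewRS.C σ ((σ ^ (i : ℕ)) (α⁻¹ * σ α)))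
    (c e : Fin n → L) (hc : c ∈ SkewRS.skewCode σ n g)
    (he : (Finset.univ.filter fun i => e i ≠ 0).card ≤ (δ - 1) / 2) :
    PGZ.decode σ α δ (c + e) = some e := by
  have hα0 : α ≠ 0 := hα.ne_zero (by omega)
  refine PGZ.decode_eq_some hn hα hα0 (by omega) (fun i hi => ?_) he
  rw [map_add, SkewRS.conjSum_apply σ α i c,
    SkewRS.sum_mul_eq_zero_of_mem_skewCode (hn ▸ pow_orderOf_eq_one σ) hα0 hg hc (by omega),
    zero_add]
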